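/- Let $(\alpha_k)_{k\ge 0}$ be a real sequence with $\alpha_0=1$ and $0<\alpha_k<1$ for $k\ge 1$, and put $\pi_i^n=\alpha_i\prod_{k=i+1}^n(1-\alpha_k)$ for $0\le i\le n$; for each $n$ this is a probability distribution on $\{0,\dots,n\}$. For $m,n\ge 0$ let $F^{mn}$ be the set of transport plans between $\pi^m$ and $\pi^n$, i.e. of real matrices $z=(z_{ij})_{0\le i\le m,\,0\le j\le n}$ with $z_{ij}\ge 0$, $\sum_{j=0}^n z_{ij}=\pi_i^m$ and $\sum_{i=0}^m z_{ij}=\pi_j^n$. Define $d_{mn}$ for $m,n\in\mathcal N=\{-1,0,1,\dots\}$ recursively by $d_{-1,-1}=0$, $d_{-1,k}=d_{k,-1}=1$ for $k\ge 0$, and $$d_{mn}=\min_{z\in F^{mn}}C^{mn}(z),\qquad C^{mn}(z)=\sum_{i=0}^m\sum_{j=0}^n z_{ij}\,d_{i-1,j-1}\qquad(m,n\ge 0).$$ A plan $z\in F^{mn}$ is optimal if it attains this minimum. For $m\le n$ the inside-out transport is the matrix computed as follows: for $j\le m$ set $z_{jj}=\pi_j^n$ and $z_{ij}=0$ for $i\ne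 j$; then treat the demands $\pi_j^n$ for $j=m+1,\dots,n$ in this order, serving each of them from the sources $i=m,m-1,\dots,0$ in this order, where source $i$ sends to $j$ the minimum of what is left of its supply $\pi_i^m$ and what is left of the demand $\pi_j^n$. Then all these minima are attained, and: (a) $(m,n)\mapsto d_{mn}$ is a metric on $\mathcal N$ with values in $[0,1]$. (b) For all $0\le m\le n$ there is an optimal plan $z\in F^{mn}$ that is simple: $z_{ii}=\pi_i^n$ for $i=0,\dots,m$, and hence $z_{ij}=0$ whenever $0\le i,j\le m$ and $i\neq j$. Moreover, for each fixed $m\in\mathcal N$, the map $n\mapsto d_{mn}$ is non-increasing on $\{n\in\mathcal N: n\le m\}$ and non-decreasing on $\{n\in\mathcal N: n\ge m\}$. (c) If $\alpha_k\ge 1/2$ for all $k$, then the 4-point inequality $$d_{il}+d_{kj}\le d_{ij}+d_{kl}\qquad\text{for all integers }0\le i\le k\le j\le l$$ holds, and for all $0\le m\le n$ the inside-out transport belongs to $F^{mn}$ and is optimal. More generally, for every sequence $(\alpha_k)$ as above for which the 4-point inequality holds, the inside-out transport is an optimal plan in $F^{mn}$ for all $0\le m\le n$. -/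

import Mathlib

namespace KMBound

/-- The weights `π_i^n = α_i ∏_{k=i+1}^n (1 - α_k)`; only used for `i ≤ n`. -/
noncomputable def weight (α : ℕ → ℝ) (n i : ℕ) : ℝ :=
  α i * ∏ k ∈ Finset.Ioc i n, (1 - α k)

/-- The polytope `F^{mn}` of transport plans between `π^m` (on `0, …, m`) and `π^n`
(on `0, …, n`). -/
def plans (α : ℕ → ℝ) (m n : ℕ) : Set (Fin (m + 1) → Fin (n + 1) → ℝ) :=
  {z | (∀ i j, 0 ≤ z i j) ∧
    (∀ i, ∑ j, z i j = weight α m i) ∧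
    (∀ j, ∑ i, z i j = weight α n j)}

/-- The recursive bounds with both indices shifted by one:
`shifted α p q` is `d_{p-1,q-1}`. -/
noncomputable def shifted (α : ℕ → ℝ) : ℕ → ℕ → ℝ
  | 0, 0 => 0
  | 0, _ + 1 => 1
  | _ + 1, 0 => 1
  | m + 1, n + 1 =>
    sInf {c | ∃ z ∈ plans α m n,
      c = ∑ i : Fin (m + 1), ∑ j : Fin (n + 1), z i j * shifted α i j}
termination_by p q => p + q
decreasing_by omega

/-- The recursive bounds `d_{mn}`, for integers `m, n ≥ -1`. -/
noncomputable def d (α : ℕ → ℝ) (m n : ℤ) : ℝ :=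
  shifted α (m + 1).toNat (n + 1).toNat

/-- The transport cost `C^{mn}(z) = ∑_{i ≤ m} ∑_{j ≤ n} z_{ij} d_{i-1,j-1}`. -/
noncomputable def cost (α : ℕ → ℝ) (m n : ℕ) (z : Fin (m + 1) → Fin (n + 1) → ℝ) : ℝ :=
  ∑ i : Fin (m + 1), ∑ j : Fin (n + 1), z i j * d α ((i : ℕ) - 1 : ℤ) ((j : ℕ) - 1 : ℤ)

theorem d_neg_one_neg_one (α : ℕ → ℝ) : d α (-1) (-1) = 0 := by
  simp [d, shifted]

theorem d_neg_one_left (α : ℕ → ℝ) (k : ℕ) : d α (-1) k = 1 := by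
  simp [d, shifted]

theorem d_neg_one_right (α : ℕ → ℝ) (k : ℕ) : d α k (-1) = 1 := by
  simp [d, shifted]

theorem d_eq_sInf (α : ℕ → ℝ) (m n : ℕ) :
    d α m n = sInf (cost α m n '' plans α m n) := by
  have h : ∀ k : ℕ, ((k : ℤ) + 1).toNat = k + 1 := fun k => by omega
  rw [d, h, h, shifted]
  congr 1
  ext c
  simp [cost, d, eq_comm]

/-- `z` is an optimal transport plan for the problem defining `d_{mn}`. -/
def IsOptimal (α : ℕ → ℝ) (m n : ℕ) (z : Fin (m + 1) → Fin (n + 1) → ℝ) : Prop :=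
  z ∈ plans α m n ∧ ∀ w ∈ plans α m n, cost α m n z ≤ cost α m n w

/-- The flows computed by the inside-out procedure, for `i ≤ m ≤ n` and `j ≤ n`. For `j ≤ m` only
the twin flow `z_{jj} = π_j^n` is used. The demands `j = m + 1, …, n` are then treated in this
order, each one being served by the sources `i = m, m - 1, …, 0` in this order: source `i` sends
to `j` the minimum of its residual supply (what it has not sent to `0, …, j - 1`) and the residual
demand of `j` (what has not arrived from `m, …, i + 1`). -/
noncomputable def insideOutFlow (α : ℕ → ℝ) (m n : ℕ) (i j : ℕ) : ℝ :=
  if j ≤ m then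
    if i = j then weight α n j else 0
  else
    min (weight α m i - ∑ j' : Fin j, insideOutFlow α m n i j')
      (weight α n j - ∑ i' : Fin (m - i), insideOutFlow α m n (m - i') j)
termination_by (j, m - i)
decreasing_by
  · exact Prod.Lex.left _ _ j'.2
  · exact Prod.Lex.right _ (by omega)

/-- The inside-out transport between `π^m` and `π^n`. -/
noncomputable def insideOut (α : ℕ → ℝ) (m n : ℕ) : Fin (m + 1) → Fin (n + 1) → ℝ :=
  fun i j => insideOutFlow α m n i j

/-- The 4-point inequality for the bounds `d_{mn}`. -/
def FourPoint (α : ℕ → ℝ) : Prop :=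
  ∀ i k j l : ℕ, i ≤ k → k ≤ j → j ≤ l → d α i l + d α k j ≤ d α i j + d α k l

end KMBound

/-! Write D(p, q) = d_{p-1,q-1} for `shifted`, so that cost i → j is D(i, j) and every claim is an
induction along the recursion. A plan always gives an upper bound on D (`IsPlan.shifted_le`), and
compactness provides one that attains it (`exists_isPlan_eq`).

The metric axioms are those of a Wasserstein distance; the triangle inequality comes from gluing
plans along the common marginal. It also makes a detour k → i → j no cheaper than k → j with i
served by itself, so an optimal plan of maximal diagonal mass is simple. Since π_i^n = Q π_i^m for i
≤ m, with Q = `tailProd α m n`, what remains is to ship (1 - Q) π_i^m to the demands in (m, n]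
(`IsResidual`). Monotonicity follows by turning an optimal residual plan for one pair into a plan,
no more expensive, for a neighbouring pair.

Listing the sources downwards from m turns the 4-point inequality into the Monge condition and the
inside-out transport into the northwest corner rule. That rule has the largest corner sums of all
plans, so double summation by parts shows that it is optimal.

If all steps are at least 1/2, the 4-point inequality is proved by induction on the largest index.
Known up to n, it gives a closed formula for D(m+1, n+1) (`shifted_eq_of_half_le`), and the mixed
second difference of this formula is a nonnegative combination of earlier instances
(`fourPoint_step`). -/

namespace KMBound

open Finset

/-- The standing assumptions on the step sizes. -/
structure Admissible (α : ℕ → ℝ) : Prop where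
  zero : α 0 = 1
  pos : ∀ k, 0 < α k
  lt_one : ∀ k, 1 ≤ k → α k < 1

/-- The product `∏_{k=m+1}^n (1 - α_k)`. -/
noncomputable def tailProd (α : ℕ → ℝ) (m n : ℕ) : ℝ :=
  ∏ k ∈ Ioc m n, (1 - α k)

/-! ### The weights and their tail products -/

section Weights

variable {α : ℕ → ℝ}

theorem tailProd_self (m : ℕ) : tailProd α m m = 1 := by simp [tailProd]

theorem tailProd_succ_right {m n : ℕ} (h : m ≤ n) :
    tailProd α m (n + 1) = tailProd α m n * (1 - α (n + 1)) := by
  rw [tailProd, Finset.prod_Ioc_succ_top (by omega), tailProd]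

theorem tailProd_mul {l m n : ℕ} (h : l ≤ m) (h' : m ≤ n) :
    tailProd α l m * tailProd α m n = tailProd α l n := by
  induction n, h' using Nat.le_induction with
  | base => simp [tailProd_self]
  | succ n hn ih => rw [tailProd_succ_right hn, tailProd_succ_right (h.trans hn), ← ih]; ring

theorem tailProd_succ_left {m n : ℕ} (h : m + 1 ≤ n) :
    tailProd α m n = (1 - α (m + 1)) * tailProd α (m + 1) n := by
  rw [← tailProd_mul (Nat.le_succ m) h, tailProd_succ_right le_rfl, tailProd_self]; ring

theorem weight_eq (n i : ℕ) : weight α n i = α i * tailProd α i n := rfl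

theorem weight_self (n : ℕ) : weight α n n = α n := by simp [weight_eq, tailProd_self]

/-- The law π^n restricted to {0, …, m} is proportional to π^m. Hence after serving its twin every
source retains the same fraction of its supply. -/
theorem weight_mul_tailProd {i m n : ℕ} (h : i ≤ m) (h' : m ≤ n) :
    weight α m i * tailProd α m n = weight α n i := by
  rw [weight_eq, weight_eq, ← tailProd_mul h h', mul_assoc]

theorem weight_succ {i n : ℕ} (h : i ≤ n) :
    weight α (n + 1) i = weight α n i * (1 - α (n + 1)) := by
  rw [← weight_mul_tailProd h (Nat.le_succ n), tailProd_succ_right le_rfl, tailProd_self, one_mul]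

theorem sum_weight_range_mul (f : ℕ → ℝ) (n : ℕ) :
    ∑ i ∈ range (n + 2), weight α (n + 1) i * f i =
      (1 - α (n + 1)) * ∑ i ∈ range (n + 1), weight α n i * f i + α (n + 1) * f (n + 1) := by
  rw [sum_range_succ, weight_self, mul_sum]
  congr 1
  refine sum_congr rfl fun i hi => ?_
  rw [weight_succ (by simp at hi; omega)]; ring

theorem sum_weight_Ioc_mul (f : ℕ → ℝ) {m n : ℕ} (h : m ≤ n) :
    ∑ i ∈ Ioc m (n + 1), weight α (n + 1) i * f i =
      (1 - α (n + 1)) * ∑ i ∈ Ioc m n, weight α n i * f i + α (n + 1) * f (n + 1) := by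
  rw [sum_Ioc_succ_top (by omega), weight_self, mul_sum]
  congr 1
  refine sum_congr rfl fun i hi => ?_
  rw [weight_succ (by simp at hi; omega)]; ring

theorem sum_weight_Ioc {m n : ℕ} (h : m ≤ n) :
    ∑ i ∈ Ioc m n, weight α n i = 1 - tailProd α m n := by
  induction n, h using Nat.le_induction with
  | base => simp [tailProd_self]
  | succ n hn ih =>
    have := sum_weight_Ioc_mul (α := α) (fun _ => 1) hn
    simp only [mul_one] at this
    rw [this, ih, tailProd_succ_right hn]; ring

theorem sum_range_eq_range_add_Ioc (f : ℕ → ℝ) {m n : ℕ} (h : m ≤ n) :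
    ∑ j ∈ range (n + 1), f j = ∑ j ∈ range (m + 1), f j + ∑ j ∈ Ioc m n, f j := by
  induction n, h using Nat.le_induction with
  | base => simp
  | succ n hn ih => rw [sum_range_succ, ih, sum_Ioc_succ_top (by omega)]; ring

namespace Admissible

variable (hα : Admissible α)
include hα

theorem one_sub_nonneg (k : ℕ) : 0 ≤ 1 - α k := by
  rcases Nat.eq_zero_or_pos k with rfl | h
  · simp [hα.zero]
  · linarith [hα.lt_one k h]

theorem tailProd_pos (m n : ℕ) : 0 < tailProd α m n :=
  prod_pos fun k hk => by
    have := hα.lt_one k (by simp at hk; omega)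
    linarith

theorem tailProd_le_one (m n : ℕ) : tailProd α m n ≤ 1 :=
  prod_le_one (fun k _ => hα.one_sub_nonneg k) fun k _ => by linarith [hα.pos k]

theorem tailProd_lt_one {m n : ℕ} (h : m < n) : tailProd α m n < 1 := by
  rw [tailProd_succ_left h]
  have h1 := hα.tailProd_le_one (m + 1) n
  have h2 := hα.one_sub_nonneg (m + 1)
  nlinarith [hα.pos (m + 1)]

theorem weight_pos (n i : ℕ) : 0 < weight α n i :=
  mul_pos (hα.pos i) (hα.tailProd_pos i n)

theorem weight_anti {i m n : ℕ} (h : i ≤ m) (h' : m ≤ n) : weight α n i ≤ weight α m i := by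
  rw [← weight_mul_tailProd h h']
  exact mul_le_of_le_one_right (hα.weight_pos m i).le (hα.tailProd_le_one m n)

theorem sum_weight (n : ℕ) : ∑ i ∈ range (n + 1), weight α n i = 1 := by
  induction n with
  | zero => simp [weight_self, hα.zero]
  | succ n ih =>
    have := sum_weight_range_mul (α := α) (fun _ => 1) n
    simp only [mul_one] at this
    rw [this, ih]; ring

end Admissible

end Weights

/-! ### Transport plans indexed by natural numbers -/

/-- A transport plan between `π^m` and `π^n`, as a function on `ℕ × ℕ` of which only the values
at `(i, j)` with `i ≤ m` and `j ≤ n` matter. -/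
structure IsPlan (α : ℕ → ℝ) (m n : ℕ) (z : ℕ → ℕ → ℝ) : Prop where
  nonneg : ∀ i ≤ m, ∀ j ≤ n, 0 ≤ z i j
  row : ∀ i ≤ m, ∑ j ∈ range (n + 1), z i j = weight α m i
  col : ∀ j ≤ n, ∑ i ∈ range (m + 1), z i j = weight α n j

/-- The cost of a transport plan indexed by natural numbers. -/
noncomputable def total (α : ℕ → ℝ) (m n : ℕ) (z : ℕ → ℕ → ℝ) : ℝ :=
  ∑ i ∈ range (m + 1), ∑ j ∈ range (n + 1), z i j * shifted α i j

/-- Extension by zero of a finite matrix. -/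
def extend {m n : ℕ} (z : Fin (m + 1) → Fin (n + 1) → ℝ) (i j : ℕ) : ℝ :=
  if h : i < m + 1 ∧ j < n + 1 then z ⟨i, h.1⟩ ⟨j, h.2⟩ else 0

/-- Restriction of a function on `ℕ × ℕ` to a finite matrix. -/
def restrict (m n : ℕ) (z : ℕ → ℕ → ℝ) (i : Fin (m + 1)) (j : Fin (n + 1)) : ℝ := z i j

section Plans

variable {α : ℕ → ℝ} {m n : ℕ}

theorem restrict_extend (z : Fin (m + 1) → Fin (n + 1) → ℝ) : restrict m n (extend z) = z := by
  ext i j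
  exact dif_pos ⟨i.2, j.2⟩

theorem restrict_mem_plans {z : ℕ → ℕ → ℝ} : restrict m n z ∈ plans α m n ↔ IsPlan α m n z := by
  simp only [plans, restrict, Set.mem_ofPred_eq]
  constructor
  · rintro ⟨h1, h2, h3⟩
    refine ⟨fun i hi j hj => h1 ⟨i, by omega⟩ ⟨j, by omega⟩, fun i hi => ?_, fun j hj => ?_⟩
    · rw [← h2 ⟨i, by omega⟩, Fin.sum_univ_eq_sum_range (fun j => z i j)]
    · rw [← h3 ⟨j, by omega⟩, Fin.sum_univ_eq_sum_range (fun i => z i j)]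
  · intro h
    refine ⟨fun i j => h.nonneg _ (by omega) _ (by omega), fun i => ?_, fun j => ?_⟩
    · rw [← h.row i (by omega), Fin.sum_univ_eq_sum_range (fun j => z i j)]
    · rw [← h.col j (by omega), Fin.sum_univ_eq_sum_range (fun i => z i j)]

theorem cost_eq_sum (z : Fin (m + 1) → Fin (n + 1) → ℝ) :
    cost α m n z = ∑ i : Fin (m + 1), ∑ j : Fin (n + 1), z i j * shifted α i j := by
  simp [cost, d]

theorem cost_restrict (z : ℕ → ℕ → ℝ) : cost α m n (restrict m n z) = total α m n z := by
  rw [cost_eq_sum, total, ← Fin.sum_univ_eq_sum_range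
    (fun i => ∑ j ∈ range (n + 1), z i j * shifted α i j)]
  refine sum_congr rfl fun i _ => ?_
  rw [← Fin.sum_univ_eq_sum_range (fun j => z i j * shifted α i j)]
  rfl

theorem d_natCast (m n : ℕ) : d α m n = shifted α (m + 1) (n + 1) := by
  have h : ∀ k : ℕ, ((k : ℤ) + 1).toNat = k + 1 := fun k => by omega
  rw [d, h, h]

theorem isClosed_plans : IsClosed (plans α m n) := by
  have : plans α m n = (⋂ i, ⋂ j, {z | 0 ≤ z i j}) ∩
      ((⋂ i : Fin (m + 1), {z | ∑ j, z i j = weight α m i}) ∩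
      ⋂ j : Fin (n + 1), {z | ∑ i, z i j = weight α n j}) := by
    ext z; simp [plans]
  rw [this]
  refine IsClosed.inter (isClosed_iInter fun i => isClosed_iInter fun j => ?_)
    (IsClosed.inter (isClosed_iInter fun i => ?_) (isClosed_iInter fun j => ?_))
  · exact isClosed_le (by fun_prop) (by fun_prop)
  · exact isClosed_eq (by fun_prop) (by fun_prop)
  · exact isClosed_eq (by fun_prop) (by fun_prop)

theorem isCompact_plans : IsCompact (plans α m n) := by
  refine IsCompact.of_isClosed_subset
    (isCompact_univ_pi fun i : Fin (m + 1) => isCompact_univ_pi fun _ : Fin (n + 1) =>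
      isCompact_Icc (a := (0 : ℝ)) (b := weight α m i)) isClosed_plans ?_
  rintro z ⟨h1, h2, -⟩ i - j -
  refine ⟨h1 i j, ?_⟩
  rw [← h2 i]
  exact single_le_sum (f := fun j => z i j) (fun j _ => h1 i j) (mem_univ j)

theorem continuous_cost : Continuous (cost α m n) := by
  unfold cost
  fun_prop

/-- The independent coupling makes the polytope nonempty, as needed for the minimum to be attained.
-/
theorem isPlan_prod (hα : Admissible α) : IsPlan α m n fun i j => weight α m i * weight α n j where
  nonneg i _ j _ := mul_nonneg (hα.weight_pos _ _).le (hα.weight_pos _ _).le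
  row i _ := by rw [← mul_sum, hα.sum_weight, mul_one]
  col j _ := by rw [← sum_mul, hα.sum_weight, one_mul]

theorem isLeast_cost (hα : Admissible α) (m n : ℕ) :
    IsLeast (cost α m n '' plans α m n) (d α m n) := by
  rw [d_eq_sInf]
  exact (isCompact_plans.image continuous_cost).isLeast_sInf
    ⟨_, _, restrict_mem_plans.2 (isPlan_prod hα), rfl⟩

theorem IsPlan.shifted_le (hα : Admissible α) {z : ℕ → ℕ → ℝ} (hz : IsPlan α m n z) :
    shifted α (m + 1) (n + 1) ≤ total α m n z := by
  rw [← d_natCast, ← cost_restrict]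
  exact (isLeast_cost hα m n).2 ⟨_, restrict_mem_plans.2 hz, rfl⟩

theorem exists_isPlan_eq (hα : Admissible α) (m n : ℕ) :
    ∃ z, IsPlan α m n z ∧ total α m n z = shifted α (m + 1) (n + 1) := by
  obtain ⟨w, hw, hc⟩ := (isLeast_cost hα m n).1
  refine ⟨extend w, ?_, ?_⟩
  · rw [← restrict_mem_plans, restrict_extend]; exact hw
  · rw [← cost_restrict, restrict_extend, hc, d_natCast]

theorem isOptimal_restrict_iff (hα : Admissible α) {z : ℕ → ℕ → ℝ} :
    IsOptimal α m n (restrict m n z) ↔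
      IsPlan α m n z ∧ total α m n z = shifted α (m + 1) (n + 1) := by
  rw [IsOptimal, restrict_mem_plans, cost_restrict]
  refine and_congr_right fun hz => ⟨fun h => ?_, fun h w hw => ?_⟩
  · obtain ⟨w, hw, hc⟩ := exists_isPlan_eq hα m n
    refine le_antisymm ?_ (hz.shifted_le hα)
    rw [← hc, ← cost_restrict w]
    exact h _ (restrict_mem_plans.2 hw)
  · rw [← restrict_extend w, restrict_mem_plans] at hw
    rw [← restrict_extend w, cost_restrict, h]
    exact hw.shifted_le hα

end Plans

/-! ### The metric -/

section Metric

variable {α : ℕ → ℝ}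

@[simp] theorem shifted_zero_zero : shifted α 0 0 = 0 := by simp [shifted]
@[simp] theorem shifted_zero_succ (n : ℕ) : shifted α 0 (n + 1) = 1 := by simp [shifted]
@[simp] theorem shifted_succ_zero (n : ℕ) : shifted α (n + 1) 0 = 1 := by simp [shifted]

theorem IsPlan.transpose {m n : ℕ} {z : ℕ → ℕ → ℝ} (hz : IsPlan α m n z) :
    IsPlan α n m fun i j => z j i :=
  ⟨fun i hi j hj => hz.nonneg j hj i hi, fun i hi => hz.col i hi, fun j hj => hz.row j hj⟩

/-- Induction principle following the recursive definition of `shifted`. -/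
theorem shifted_induction {P : ℕ → ℕ → Prop} (h00 : P 0 0) (h0 : ∀ n, P 0 (n + 1))
    (h1 : ∀ m, P (m + 1) 0)
    (h : ∀ m n, (∀ i ≤ m, ∀ j ≤ n, P i j) → P (m + 1) (n + 1)) (p q : ℕ) : P p q := by
  induction p using Nat.strong_induction_on generalizing q with
  | _ p ih =>
    cases p with
    | zero =>
      cases q with
      | zero => exact h00
      | succ q => exact h0 q
    | succ p =>
      cases q with
      | zero => exact h1 p
      | succ q => exact h p q fun i hi j _ => ih i (by omega) j

theorem Admissible.shifted_mem_Icc (hα : Admissible α) (p q : ℕ) :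
    shifted α p q ∈ Set.Icc (0 : ℝ) 1 := by
  refine shifted_induction (P := fun p q => shifted α p q ∈ Set.Icc (0 : ℝ) 1)
    (by simp) (by simp) (by simp) (fun m n ih => ?_) p q
  obtain ⟨z, hz, hc⟩ := exists_isPlan_eq hα m n
  have hterm : ∀ i ∈ range (m + 1), ∀ j ∈ range (n + 1),
      0 ≤ z i j ∧ shifted α i j ∈ Set.Icc (0 : ℝ) 1 := fun i hi j hj =>
    have hi' : i ≤ m := by simp at hi; omega
    have hj' : j ≤ n := by simp at hj; omega
    ⟨hz.nonneg i hi' j hj', ih i hi' j hj'⟩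
  constructor
  · rw [← hc]
    exact sum_nonneg fun i hi => sum_nonneg fun j hj =>
      mul_nonneg (hterm i hi j hj).1 (hterm i hi j hj).2.1
  · rw [← hc, ← hα.sum_weight m]
    refine sum_le_sum fun i hi => ?_
    rw [← hz.row i (by simp at hi; omega)]
    exact sum_le_sum fun j hj => mul_le_of_le_one_right (hterm i hi j hj).1 (hterm i hi j hj).2.2

theorem Admissible.shifted_nonneg (hα : Admissible α) (p q : ℕ) : 0 ≤ shifted α p q :=
  (hα.shifted_mem_Icc p q).1

theorem Admissible.shifted_le_one (hα : Admissible α) (p q : ℕ) : shifted α p q ≤ 1 :=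
  (hα.shifted_mem_Icc p q).2

theorem Admissible.shifted_comm (hα : Admissible α) (p q : ℕ) :
    shifted α p q = shifted α q p := by
  refine shifted_induction (P := fun p q => shifted α p q = shifted α q p)
    rfl (by simp) (by simp) (fun m n ih => ?_) p q
  have htot : ∀ z : ℕ → ℕ → ℝ, total α n m (fun i j => z j i) = total α m n z := fun z => by
    rw [total, sum_comm, total]
    refine sum_congr rfl fun i hi => sum_congr rfl fun j hj => ?_
    rw [ih i (by simp at hi; omega) j (by simp at hj; omega)]
  apply le_antisymm
  · obtain ⟨z, hz, hc⟩ := exists_isPlan_eq hα n m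
    rw [← hc]
    exact (hz.transpose.shifted_le hα).trans_eq (htot fun i j => z j i).symm
  · obtain ⟨z, hz, hc⟩ := exists_isPlan_eq hα m n
    rw [← hc, ← htot z]
    exact hz.transpose.shifted_le hα

theorem Admissible.shifted_self (hα : Admissible α) (p : ℕ) : shifted α p p = 0 := by
  induction p using Nat.strong_induction_on with
  | _ p ih =>
    cases p with
    | zero => simp
    | succ m =>
      refine le_antisymm ?_ (hα.shifted_nonneg _ _)
      have hz : IsPlan α m m fun i j => if i = j then weight α m i else 0 := by
        refine ⟨fun i _ j _ => ?_, fun i hi => ?_, fun j hj => ?_⟩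
        · split_ifs
          exacts [(hα.weight_pos _ _).le, le_rfl]
        · rw [sum_ite_eq, if_pos (by simp; omega)]
        · rw [sum_ite_eq', if_pos (by simp; omega)]
      refine (hz.shifted_le hα).trans_eq (sum_eq_zero fun i hi => sum_eq_zero fun j _ => ?_)
      by_cases h : i = j
      · rw [← h, ih i (by simp at hi; omega), mul_zero]
      · simp [h]

theorem Admissible.shifted_pos_of_lt (hα : Admissible α) {p q : ℕ} (h : p < q) :
    0 < shifted α p q := by
  refine shifted_induction (P := fun p q => p < q → 0 < shifted α p q)
    (by simp) (by simp) (by simp) (fun m n ih hmn => ?_) p q h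
  obtain ⟨z, hz, hc⟩ := exists_isPlan_eq hα m n
  rw [← hc]
  have hnn : ∀ i ∈ range (m + 1), ∀ j ∈ range (n + 1), 0 ≤ z i j * shifted α i j :=
    fun i hi j hj => mul_nonneg (hz.nonneg i (by simp at hi; omega) j (by simp at hj; omega))
      (hα.shifted_nonneg _ _)
  -- The demand at n is positive, so some source i ≤ m < n serves it, and D(i, n) > 0 by induction.
  have hcol : 0 < ∑ i ∈ range (m + 1), z i n := by
    rw [hz.col n le_rfl]; exact hα.weight_pos _ _
  obtain ⟨i, hi, hpos⟩ := exists_lt_of_sum_lt (s := range (m + 1)) (f := fun _ => (0 : ℝ))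
    (by simpa using hcol)
  have hi' : i ≤ m := by simp at hi; omega
  refine sum_pos' (fun i hi => sum_nonneg (hnn i hi)) ⟨i, hi, ?_⟩
  exact sum_pos' (hnn i hi) ⟨n, by simp, mul_pos hpos (ih i hi' n le_rfl (by omega))⟩

theorem Admissible.shifted_eq_zero_iff (hα : Admissible α) {p q : ℕ} :
    shifted α p q = 0 ↔ p = q := by
  refine ⟨fun h => ?_, fun h => h ▸ hα.shifted_self p⟩
  rcases lt_trichotomy p q with h' | h' | h'
  · exact absurd h (hα.shifted_pos_of_lt h').ne'
  · exact h'
  · rw [hα.shifted_comm] at h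
    exact absurd h (hα.shifted_pos_of_lt h').ne'

/-- Gluing two plans along their common marginal. -/
theorem IsPlan.glue (hα : Admissible α) {m p n : ℕ} {z w : ℕ → ℕ → ℝ} (hz : IsPlan α m p z)
    (hw : IsPlan α p n w) :
    IsPlan α m n fun i j => ∑ k ∈ range (p + 1), z i k * w k j / weight α p k := by
  have hle : ∀ {k}, k ∈ range (p + 1) → k ≤ p := fun hk => by simp at hk; omega
  refine ⟨fun i hi j hj => sum_nonneg fun k hk => div_nonneg (mul_nonneg
    (hz.nonneg i hi k (hle hk)) (hw.nonneg k (hle hk) j hj)) (hα.weight_pos _ _).le,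
    fun i hi => ?_, fun j hj => ?_⟩
  · rw [sum_comm, ← hz.row i hi]
    refine sum_congr rfl fun k hk => ?_
    rw [← sum_div, ← mul_sum, hw.row k (hle hk), mul_div_cancel_right₀ _ (hα.weight_pos _ _).ne']
  · rw [sum_comm, ← hw.col j hj]
    refine sum_congr rfl fun k hk => ?_
    rw [← sum_div, ← sum_mul, hz.col k (hle hk), mul_div_cancel_left₀ _ (hα.weight_pos _ _).ne']

/-- Optimal plans m → r and r → n glue to a plan m → n carried by triples (i, k, j). The inductive
triangle inequality D(i, j) ≤ D(i, k) + D(k, j), integrated over the triples, bounds its cost. -/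
theorem Admissible.shifted_triangle (hα : Admissible α) (p q r : ℕ) :
    shifted α p q ≤ shifted α p r + shifted α r q := by
  refine shifted_induction
    (P := fun p q => ∀ r, shifted α p q ≤ shifted α p r + shifted α r q)
    (fun r => ?_) (fun n r => ?_) (fun m r => ?_) (fun m n ih r => ?_) p q r
  · simpa using add_nonneg (hα.shifted_nonneg _ _) (hα.shifted_nonneg _ _)
  · cases r with
    | zero => simp
    | succ r => simpa using hα.shifted_nonneg _ _
  · cases r with
    | zero => simp
    | succ r => simpa using hα.shifted_nonneg _ _
  cases r with
  | zero => simpa using (hα.shifted_le_one _ _).trans (by norm_num)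
  | succ r =>
  obtain ⟨z, hz, hzc⟩ := exists_isPlan_eq hα m r
  obtain ⟨w, hw, hwc⟩ := exists_isPlan_eq hα r n
  have hle : ∀ {k l}, k ∈ range (l + 1) → k ≤ l := fun hk => by simp at hk; omega
  refine ((hz.glue hα hw).shifted_le hα).trans ?_
  have h1 : total α m r z = ∑ i ∈ range (m + 1), ∑ j ∈ range (n + 1), ∑ k ∈ range (r + 1),
      z i k * w k j / weight α r k * shifted α i k := by
    refine sum_congr rfl fun i hi => ?_
    rw [sum_comm]
    refine sum_congr rfl fun k hk => ?_
    rw [← sum_mul, ← sum_div, ← mul_sum, hw.row k (hle hk),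
      mul_div_cancel_right₀ _ (hα.weight_pos _ _).ne']
  have h2 : total α r n w = ∑ i ∈ range (m + 1), ∑ j ∈ range (n + 1), ∑ k ∈ range (r + 1),
      z i k * w k j / weight α r k * shifted α k j := by
    rw [total, sum_comm, sum_comm (s := range (m + 1))]
    refine sum_congr rfl fun j hj => ?_
    rw [sum_comm (s := range (m + 1))]
    refine sum_congr rfl fun k hk => ?_
    rw [← sum_mul, ← sum_div, ← sum_mul, hz.col k (hle hk),
      mul_div_cancel_left₀ _ (hα.weight_pos _ _).ne']
  rw [← hzc, ← hwc, h1, h2, total, ← sum_add_distrib]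
  refine sum_le_sum fun i hi => ?_
  rw [← sum_add_distrib]
  refine sum_le_sum fun j hj => ?_
  rw [← sum_add_distrib, sum_mul]
  refine sum_le_sum fun k hk => ?_
  rw [← mul_add]
  exact mul_le_mul_of_nonneg_left (ih i (hle hi) j (hle hj) k) (div_nonneg (mul_nonneg
    (hz.nonneg i (hle hi) k (hle hk)) (hw.nonneg k (hle hk) j (hle hj))) (hα.weight_pos _ _).le)

end Metric

end KMBound

namespace KMBound

open Finset

/-! ### Simple plans -/

section Simple

variable {α : ℕ → ℝ}

/-- Replacing a bit of the flows `k → i` and `i → j` by flows `k → j` and `i → i`. -/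
theorem IsPlan.reroute {m n : ℕ} {z : ℕ → ℕ → ℝ} (hz : IsPlan α m n z) {i j k : ℕ}
    (hi : i ≤ m) (hin : i ≤ n) (hj : j ≤ n) (hk : k ≤ m) (hki : k ≠ i) (hji : j ≠ i) {ε : ℝ}
    (hε : 0 ≤ ε) (h1 : ε ≤ z k i) (h2 : ε ≤ z i j) :
    IsPlan α m n fun a b => z a b +
      ε * (((if a = i then 1 else 0) - if a = k then 1 else 0) *
        ((if b = i then 1 else 0) - if b = j then 1 else 0)) := by
  have hmem : ∀ {a l : ℕ}, a ≤ l → a ∈ range (l + 1) := fun h => by simp; omega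
  refine ⟨fun a ha b hb => ?_, fun a ha => ?_, fun b hb => ?_⟩
  · have := hz.nonneg a ha b hb
    by_cases hai : a = i
    · subst hai
      by_cases hbj : b = j
      · subst hbj; simp [hki.symm, hji]; linarith
      · rw [if_neg hbj, if_neg hki.symm, if_pos rfl]
        split_ifs <;> simp <;> linarith
    · by_cases hak : a = k
      · subst hak
        by_cases hbi : b = i
        · subst hbi; simp [hki, hji.symm]; linarith
        · rw [if_neg hbi, if_neg hki, if_pos rfl]
          split_ifs <;> simp <;> linarith
      · simpa [hai, hak] using this
  · rw [sum_add_distrib, hz.row a ha, ← mul_sum, ← mul_sum, sum_sub_distrib, sum_ite_eq',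
      sum_ite_eq', if_pos (hmem hin), if_pos (hmem hj)]
    ring
  · rw [sum_add_distrib, hz.col b hb, ← mul_sum, ← sum_mul, sum_sub_distrib, sum_ite_eq',
      sum_ite_eq', if_pos (hmem hi), if_pos (hmem hk)]
    ring

theorem sum_sum_rank_one {m n i j k : ℕ} (hi : i ≤ m) (hin : i ≤ n) (hj : j ≤ n) (hk : k ≤ m)
    (f : ℕ → ℕ → ℝ) :
    ∑ a ∈ range (m + 1), ∑ b ∈ range (n + 1),
      (((if a = i then 1 else 0) - if a = k then 1 else 0) *
        ((if b = i then 1 else 0) - if b = j then 1 else 0)) * f a b =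
      f i i - f i j - f k i + f k j := by
  have hmem : ∀ {a l : ℕ}, a ≤ l → a ∈ range (l + 1) := fun h => by simp; omega
  have h1 : ∀ a, ∑ b ∈ range (n + 1), (((if a = i then 1 else 0) - if a = k then 1 else 0) *
        ((if b = i then (1 : ℝ) else 0) - if b = j then 1 else 0)) * f a b =
      ((if a = i then 1 else 0) - if a = k then 1 else 0) * (f a i - f a j) := fun a => by
    simp_rw [mul_assoc, ← mul_sum, sub_mul, sum_sub_distrib, ite_mul, one_mul, zero_mul,
      sum_ite_eq', if_pos (hmem hin), if_pos (hmem hj)]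
  simp_rw [h1, sub_mul, sum_sub_distrib, ite_mul, one_mul, zero_mul, sum_ite_eq', if_pos (hmem hi),
    if_pos (hmem hk)]
  ring

/-- The optimal plans form a compact set, on which the continuous diagonal mass attains its maximum.
-/
theorem exists_isPlan_eq_maximal_diag (hα : Admissible α) {m n : ℕ} (h : m ≤ n) :
    ∃ z, IsPlan α m n z ∧ total α m n z = shifted α (m + 1) (n + 1) ∧
      ∀ w, IsPlan α m n w → total α m n w = shifted α (m + 1) (n + 1) →
        ∑ i ∈ range (m + 1), w i i ≤ ∑ i ∈ range (m + 1), z i i := by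
  have hdiag : ∀ w : ℕ → ℕ → ℝ, ∑ i : Fin (m + 1),
      restrict m n w i (Fin.castLE (by omega) i) = ∑ i ∈ range (m + 1), w i i := fun w => by
    rw [← Fin.sum_univ_eq_sum_range (fun i => w i i)]
    rfl
  have hcpt : IsCompact (plans α m n ∩ cost α m n ⁻¹' {shifted α (m + 1) (n + 1)}) :=
    isCompact_plans.inter_right (isClosed_singleton.preimage continuous_cost)
  obtain ⟨z₀, hz₀, hc₀⟩ := exists_isPlan_eq hα m n
  obtain ⟨z, ⟨hz, hc⟩, hmax⟩ := hcpt.exists_isMaxOn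
    ⟨restrict m n z₀, restrict_mem_plans.2 hz₀, by simpa [cost_restrict] using hc₀⟩
    (f := fun z => ∑ i : Fin (m + 1), z i (Fin.castLE (by omega) i))
    (Continuous.continuousOn (by fun_prop))
  rw [← restrict_extend z] at hz hc hmax
  refine ⟨extend z, restrict_mem_plans.1 hz, by simpa [cost_restrict] using hc, fun w hw hwc => ?_⟩
  have := hmax (a := restrict m n w) ⟨restrict_mem_plans.2 hw, by simpa [cost_restrict] using hwc⟩
  simpa only [Set.mem_ofPred_eq, hdiag] using this

theorem IsPlan.diag_le {m n : ℕ} {z : ℕ → ℕ → ℝ} (hz : IsPlan α m n z) {i : ℕ}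
    (hi : i ≤ m) (hin : i ≤ n) : z i i ≤ weight α n i := by
  rw [← hz.col i hin]
  exact single_le_sum (f := fun a => z a i)
    (fun a ha => hz.nonneg a (by simp at ha; omega) i hin) (by simp; omega)

/-- The twin already meets the whole demand of column j, leaving nothing for other sources. -/
theorem IsPlan.eq_zero_of_simple {m n : ℕ} {z : ℕ → ℕ → ℝ} (hz : IsPlan α m n z) (h : m ≤ n)
    (hs : ∀ i ≤ m, z i i = weight α n i) {i j : ℕ} (hi : i ≤ m) (hj : j ≤ m) (hij : i ≠ j) :
    z i j = 0 := by
  have hcol := hz.col j (hj.trans h)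
  rw [← add_sum_erase _ _ (show j ∈ range (m + 1) by simp; omega), hs j hj] at hcol
  have h0 : ∑ x ∈ (range (m + 1)).erase j, z x j = 0 := by linarith
  rw [sum_eq_zero_iff_of_nonneg fun x hx =>
    hz.nonneg x (by simp at hx; omega) j (hj.trans h)] at h0
  exact h0 i (by simp; omega)

/-- There is an optimal plan which is simple. -/
theorem exists_simple_isPlan_eq (hα : Admissible α) {m n : ℕ} (h : m ≤ n) :
    ∃ z, IsPlan α m n z ∧ total α m n z = shifted α (m + 1) (n + 1) ∧
      ∀ i ≤ m, z i i = weight α n i := by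
  obtain ⟨z, hz, hc, hmax⟩ := exists_isPlan_eq_maximal_diag hα h
  refine ⟨z, hz, hc, fun i hi => le_antisymm (hz.diag_le hi (hi.trans h)) ?_⟩
  -- If z_ii < π_i^n ≤ π_i^m, then some k ≠ i sends to i and i sends to some j ≠ i. Rerouting them
  -- keeps optimality by the triangle inequality but increases the diagonal mass.
  by_contra! hlt
  have hin := hi.trans h
  obtain ⟨k, hk, hkpos⟩ : ∃ k ∈ (range (m + 1)).erase i, 0 < z k i := by
    refine exists_lt_of_sum_lt (f := fun _ => (0 : ℝ)) ?_
    have := hz.col i hin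
    rw [← add_sum_erase _ _ (show i ∈ range (m + 1) by simp; omega)] at this
    rw [sum_const_zero]; linarith
  obtain ⟨j, hj, hjpos⟩ : ∃ j ∈ (range (n + 1)).erase i, 0 < z i j := by
    refine exists_lt_of_sum_lt (f := fun _ => (0 : ℝ)) ?_
    have := hz.row i hi
    rw [← add_sum_erase _ _ (show i ∈ range (n + 1) by simp; omega)] at this
    have := hα.weight_anti hi h
    rw [sum_const_zero]; linarith
  obtain ⟨hki, hk⟩ := mem_erase.1 hk
  obtain ⟨hji, hj⟩ := mem_erase.1 hj
  have hk : k ≤ m := by simp at hk; omega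
  have hj : j ≤ n := by simp at hj; omega
  set ε := min (z k i) (z i j)
  have hεpos : 0 < ε := lt_min hkpos hjpos
  have hw := hz.reroute hi hin hj hk hki hji hεpos.le (min_le_left _ _) (min_le_right _ _)
  set w := fun a b => z a b +
      ε * (((if a = i then 1 else 0) - if a = k then 1 else 0) *
        ((if b = i then 1 else 0) - if b = j then 1 else 0)) with hwdef
  have hwc : total α m n w = total α m n z + ε * (shifted α i i - shifted α i j - shifted α k i
      + shifted α k j) := by
    rw [← sum_sum_rank_one hi hin hj hk, mul_sum, total, total, ← sum_add_distrib]
    refine sum_congr rfl fun a _ => ?_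
    rw [mul_sum, ← sum_add_distrib]
    exact sum_congr rfl fun b _ => by simp only [hwdef]; ring
  have htri := hα.shifted_triangle k j i
  have hwopt : total α m n w = shifted α (m + 1) (n + 1) := by
    refine le_antisymm ?_ (hw.shifted_le hα)
    rw [hwc, hc, hα.shifted_self]
    nlinarith
  have hd := hmax w hw hwopt
  -- The diagonal gains at i, and once more if the new flow k → j is itself diagonal; it never
  -- loses.
  have hone : ∑ a ∈ range (m + 1), (((if a = i then (1 : ℝ) else 0) - if a = k then 1 else 0) *
        ((if a = i then 1 else 0) - if a = j then 1 else 0)) =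
      1 + if k = j then 1 else 0 := by
    simp_rw [sub_mul, sum_sub_distrib, ite_mul, one_mul, zero_mul, sum_ite_eq']
    simp [hki, hji.symm, hi, hk]
  simp only [hwdef] at hd
  rw [sum_add_distrib, ← mul_sum, hone] at hd
  have : (0 : ℝ) ≤ if k = j then 1 else 0 := by split_ifs <;> norm_num
  nlinarith

end Simple

/-! ### Residual plans -/

/-- The part of a simple plan outside of the diagonal: it sends the residual supplies
`π_i^m - π_i^n` to the demands `π_j^n` for `m < j ≤ n`. -/
structure IsResidual (α : ℕ → ℝ) (m n : ℕ) (y : ℕ → ℕ → ℝ) : Prop where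
  nonneg : ∀ i ≤ m, ∀ j ∈ Ioc m n, 0 ≤ y i j
  row : ∀ i ≤ m, ∑ j ∈ Ioc m n, y i j = weight α m i * (1 - tailProd α m n)
  col : ∀ j ∈ Ioc m n, ∑ i ∈ range (m + 1), y i j = weight α n j

/-- The cost of a residual plan. -/
noncomputable def residualCost (α : ℕ → ℝ) (m n : ℕ) (y : ℕ → ℕ → ℝ) : ℝ :=
  ∑ i ∈ range (m + 1), ∑ j ∈ Ioc m n, y i j * shifted α i j

section Residual

variable {α : ℕ → ℝ} {m n : ℕ}

theorem total_eq_residualCost (hα : Admissible α) (h : m ≤ n) {z : ℕ → ℕ → ℝ}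
    (hs : ∀ i ≤ m, ∀ j ≤ m, i ≠ j → z i j = 0) : total α m n z = residualCost α m n z := by
  refine sum_congr rfl fun i hi => ?_
  rw [sum_range_eq_range_add_Ioc _ h, sum_eq_zero, zero_add]
  intro j hj
  by_cases hij : i = j
  · rw [hij, hα.shifted_self, mul_zero]
  · rw [hs i (by simp at hi; omega) j (by simp at hj; omega) hij, zero_mul]

/-- The simple plan with given residual part. -/
noncomputable def ofResidual (α : ℕ → ℝ) (m n : ℕ) (y : ℕ → ℕ → ℝ) (i j : ℕ) : ℝ :=
  if j ≤ m then if i = j then weight α n j else 0 else y i j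

theorem residualCost_ofResidual (y : ℕ → ℕ → ℝ) :
    residualCost α m n (ofResidual α m n y) = residualCost α m n y := by
  refine sum_congr rfl fun i _ => sum_congr rfl fun j hj => ?_
  rw [ofResidual, if_neg (by simp at hj; omega)]

theorem IsResidual.isPlan (hα : Admissible α) (h : m ≤ n) {y : ℕ → ℕ → ℝ}
    (hy : IsResidual α m n y) : IsPlan α m n (ofResidual α m n y) := by
  refine ⟨fun i hi j hj => ?_, fun i hi => ?_, fun j hj => ?_⟩
  · unfold ofResidual
    split_ifs with h1 h2
    · exact (hα.weight_pos _ _).le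
    · exact le_rfl
    · exact hy.nonneg i hi j (by simp; omega)
  · have h1 : ∑ j ∈ range (m + 1), ofResidual α m n y i j = weight α n i := by
      rw [← if_pos (c := i ∈ range (m + 1)) (t := weight α n i) (e := 0) (by simp; omega),
        ← sum_ite_eq (range (m + 1)) i (fun j => weight α n j)]
      exact sum_congr rfl fun j hj => if_pos (by simp at hj; omega)
    have h2 : ∑ j ∈ Ioc m n, ofResidual α m n y i j = ∑ j ∈ Ioc m n, y i j :=
      sum_congr rfl fun j hj => if_neg (by simp at hj; omega)
    rw [sum_range_eq_range_add_Ioc _ h, h1, h2, hy.row i hi, ← weight_mul_tailProd hi h]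
    ring
  · by_cases hjm : j ≤ m
    · simp only [ofResidual, if_pos hjm, sum_ite_eq']
      exact if_pos (by simp; omega)
    · simp only [ofResidual, if_neg hjm]
      exact hy.col j (by simp; omega)

theorem total_ofResidual (hα : Admissible α) (h : m ≤ n) (y : ℕ → ℕ → ℝ) :
    total α m n (ofResidual α m n y) = residualCost α m n y := by
  rw [total_eq_residualCost hα h, residualCost_ofResidual]
  intro i _ j hj hij
  rw [ofResidual, if_pos hj, if_neg hij]

theorem IsResidual.shifted_le (hα : Admissible α) (h : m ≤ n) {y : ℕ → ℕ → ℝ}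
    (hy : IsResidual α m n y) : shifted α (m + 1) (n + 1) ≤ residualCost α m n y := by
  rw [← total_ofResidual hα h]
  exact (hy.isPlan hα h).shifted_le hα

theorem exists_isResidual_eq (hα : Admissible α) (h : m ≤ n) :
    ∃ y, IsResidual α m n y ∧ residualCost α m n y = shifted α (m + 1) (n + 1) := by
  obtain ⟨z, hz, hc, hs⟩ := exists_simple_isPlan_eq hα h
  have h0 := fun i hi j hj => hz.eq_zero_of_simple h hs (i := i) (j := j) hi hj
  refine ⟨z, ⟨fun i hi j hj => hz.nonneg i hi j (by simp at hj; omega), fun i hi => ?_,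
    fun j hj => hz.col j (by simp at hj; omega)⟩, ?_⟩
  · have := hz.row i hi
    rw [sum_range_eq_range_add_Ioc _ h, sum_eq_single_of_mem i (by simp; omega)
      (fun j hj hne => h0 i hi j (by simp at hj; omega) hne.symm), hs i hi,
      ← weight_mul_tailProd hi h] at this
    linarith
  · rw [← hc, total_eq_residualCost hα h h0]

end Residual

/-! ### Monotonicity -/

section Monotone

variable {α : ℕ → ℝ}

/-- Take an optimal residual plan for (m, n+1), spread what goes to n+1 over (m, n] in proportion to
π^n, and rescale. Costs do not rise, since D(i, j) ≤ D(i, n+1) by induction. -/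
theorem Admissible.shifted_succ_right_le (hα : Admissible α) {p q : ℕ} (h : p ≤ q) :
    shifted α p q ≤ shifted α p (q + 1) := by
  induction p using Nat.strong_induction_on generalizing q with
  | _ p ih =>
    cases p with
    | zero => simpa using hα.shifted_le_one _ _
    | succ m =>
    obtain ⟨n, rfl⟩ : ∃ n, q = n + 1 := ⟨q - 1, by omega⟩
    rcases (show m ≤ n by omega).eq_or_lt with rfl | hmn
    · rw [hα.shifted_self]; exact hα.shifted_nonneg _ _
    have hmono : ∀ i ≤ m, ∀ j ∈ Ioc m n, shifted α i j ≤ shifted α i (n + 1) := by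
      intro i hi j hj
      have hj' : i ≤ j ∧ j ≤ n + 1 := by simp at hj; omega
      have : ∀ l, j ≤ l → shifted α i j ≤ shifted α i l := fun l hl => by
        induction l, hl using Nat.le_induction with
        | base => exact le_rfl
        | succ l hl IH => exact IH.trans (ih i (by omega) (by omega))
      exact this _ hj'.2
    obtain ⟨z, hz, hc⟩ := exists_isResidual_eq hα (show m ≤ n + 1 by omega)
    set Q := tailProd α m n with hQ
    have hQ1 : Q < 1 := hα.tailProd_lt_one hmn
    have hQ0 : 0 < Q := hα.tailProd_pos m n
    have hβ := hα.pos (n + 1)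
    have hβ1 := hα.lt_one (n + 1) (by omega)
    have hQ' : tailProd α m (n + 1) = Q * (1 - α (n + 1)) := tailProd_succ_right hmn.le
    have hden : 0 < 1 - Q * (1 - α (n + 1)) := by nlinarith
    have hsumw : ∑ j ∈ Ioc m n, weight α n j = 1 - Q := sum_weight_Ioc hmn.le
    have hrow : ∀ i ≤ m, ∑ j ∈ Ioc m n, z i j = weight α m i * (1 - Q * (1 - α (n + 1)))
        - z i (n + 1) := fun i hi => by
      have := hz.row i hi
      rw [sum_Ioc_succ_top (by omega), hQ'] at this
      linarith
    have hcollast : ∑ i ∈ range (m + 1), z i (n + 1) = α (n + 1) := by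
      rw [hz.col (n + 1) (by simp; omega), weight_self]
    have hlast : ∀ i ≤ m, 0 ≤ z i (n + 1) := fun i hi => hz.nonneg i hi _ (by simp; omega)
    have hnn : ∀ i ≤ m, ∀ j ∈ Ioc m n, 0 ≤ z i j := fun i hi j hj =>
      hz.nonneg i hi j (by simp at hj ⊢; omega)
    -- Up to the factor (1 - Q) / (1 - Q(1 - β)), with β = α_{n+1}, this is z_ij + z_{i,n+1} π_j^n /
    -- (1 - Q). The factor corrects the row sums from (m, n+1) to (m, n).
    have hy : IsResidual α m n fun i j => (1 - Q * (1 - α (n + 1)))⁻¹ *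
        ((1 - Q) * z i j + z i (n + 1) * weight α n j) := by
      refine ⟨fun i hi j hj => ?_, fun i hi => ?_, fun j hj => ?_⟩
      · exact mul_nonneg (inv_pos.2 hden).le (add_nonneg (mul_nonneg (by linarith)
          (hnn i hi j hj)) (mul_nonneg (hlast i hi) (hα.weight_pos _ _).le))
      · rw [← mul_sum, sum_add_distrib, ← mul_sum, ← mul_sum, hrow i hi, hsumw]
        field_simp
        ring
      · rw [← mul_sum, sum_add_distrib, ← mul_sum, ← sum_mul, hcollast,
          hz.col j (by simp at hj ⊢; omega), weight_succ (by simp at hj; omega)]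
        field_simp
        ring
    refine (hy.shifted_le hα hmn.le).trans ?_
    rw [← hc]
    refine sum_le_sum fun i hi => ?_
    have hi : i ≤ m := by simp at hi; omega
    have hcmp : ∑ j ∈ Ioc m n, ((1 - Q) * z i j + z i (n + 1) * weight α n j) * shifted α i j ≤
        (1 - Q * (1 - α (n + 1))) *
          (∑ j ∈ Ioc m n, z i j * shifted α i j + z i (n + 1) * shifted α i (n + 1)) := by
      have h1 : 0 ≤ ∑ j ∈ Ioc m n, z i j * shifted α i j :=
        sum_nonneg fun j hj => mul_nonneg (hnn i hi j hj) (hα.shifted_nonneg _ _)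
      have h2 : ∑ j ∈ Ioc m n, weight α n j * shifted α i j ≤ (1 - Q) * shifted α i (n + 1) := by
        rw [← hsumw, sum_mul]
        exact sum_le_sum fun j hj =>
          mul_le_mul_of_nonneg_left (hmono i hi j hj) (hα.weight_pos _ _).le
      have h3 := mul_le_mul_of_nonneg_left h2 (hlast i hi)
      -- The slack comes from (1 - Q(1 - β)) - (1 - Q) = Qβ ≥ 0.
      have h4 : 0 ≤ Q * α (n + 1) * (∑ j ∈ Ioc m n, z i j * shifted α i j
          + z i (n + 1) * shifted α i (n + 1)) :=
        mul_nonneg (by positivity) (add_nonneg h1 (mul_nonneg (hlast i hi)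
          (hα.shifted_nonneg _ _)))
      simp_rw [add_mul, sum_add_distrib, mul_assoc, ← mul_sum]
      linarith
    rw [sum_Ioc_succ_top (by omega)]
    simp_rw [mul_assoc, ← mul_sum]
    rw [inv_mul_le_iff₀ hden]
    exact hcmp

/-- Shrink an optimal residual plan for (m, n) by a factor c and let the new source m+1 send the
missing share 1 - c of each demand in (m, n]. By induction D(m+1, j) ≤ D(i, j) for i ≤ m < j, so the
replacement costs no more. -/
theorem Admissible.shifted_succ_left_le (hα : Admissible α) {p q : ℕ} (h : p + 1 ≤ q) :
    shifted α (p + 1) q ≤ shifted α p q := by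
  induction q using Nat.strong_induction_on generalizing p with
  | _ q ih =>
    obtain ⟨n, rfl⟩ : ∃ n, q = n + 1 := ⟨q - 1, by omega⟩
    cases p with
    | zero => simpa using hα.shifted_le_one _ _
    | succ m =>
    have hmn : m + 1 ≤ n := by omega
    have hmono : ∀ i ≤ m, ∀ j ∈ Ioc m n, shifted α (m + 1) j ≤ shifted α i j := by
      intro i hi j hj
      have hj' : m + 1 ≤ j ∧ j ≤ n := by simp at hj; omega
      have : ∀ l, i ≤ l → l ≤ j → shifted α l j ≤ shifted α i j := fun l hl => by
        induction l, hl using Nat.le_induction with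
        | base => exact fun _ => le_rfl
        | succ l hl IH => exact fun hlj => (ih j (by omega) hlj).trans (IH (by omega))
      exact this _ (by omega) hj'.1
    obtain ⟨z, hz, hc⟩ := exists_isResidual_eq hα (show m ≤ n by omega)
    set a := α (m + 1) with ha
    set P := tailProd α (m + 1) n with hP
    have hP0 : 0 < P := hα.tailProd_pos _ _
    have hP1 : P ≤ 1 := hα.tailProd_le_one _ _
    have ha0 : 0 < a := hα.pos _
    have ha1 : a < 1 := hα.lt_one _ (by omega)
    have hQ : tailProd α m n = (1 - a) * P := tailProd_succ_left hmn
    have hden : 0 < 1 - (1 - a) * P := by nlinarith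
    -- Source i ≤ m now has π_i^m (1 - a)(1 - P) left after serving its twin, against π_i^m (1 - (1
    -- - a)P) before; c is the ratio. Then 1 - c is exactly what exhausts the supply a of source
    -- m+1.
    set c := (1 - a) * (1 - P) / (1 - (1 - a) * P) with hcdef
    have hc0 : 0 ≤ c := div_nonneg (mul_nonneg (by linarith) (by linarith)) hden.le
    have hc1 : 1 - c = a / (1 - (1 - a) * P) := by
      rw [hcdef, eq_div_iff hden.ne', sub_mul, div_mul_cancel₀ _ hden.ne']
      ring
    have hc1' : 0 ≤ 1 - c := by rw [hc1]; positivity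
    have hcQ : c * (1 - (1 - a) * P) = (1 - a) * (1 - P) := div_mul_cancel₀ _ hden.ne'
    have hmem : ∀ {i l : ℕ}, i ∈ range (l + 1) → i ≤ l := fun h => by simp at h; omega
    set y : ℕ → ℕ → ℝ := fun i j =>
      if j ≤ m then if i = j then weight α n j else 0
      else if i ≤ m then c * z i j else (1 - c) * weight α n j with hydef
    have hylow : ∀ i, ∀ j ≤ m, y i j = if i = j then weight α n j else 0 := fun i j hj =>
      if_pos hj
    have hyup : ∀ i ≤ m, ∀ j ∈ Ioc m n, y i j = c * z i j := fun i hi j hj => by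
      simp only [hydef]
      rw [if_neg (by simp at hj; omega), if_pos hi]
    have hylast : ∀ j ∈ Ioc m n, y (m + 1) j = (1 - c) * weight α n j := fun j hj => by
      simp only [hydef]
      rw [if_neg (by simp at hj; omega), if_neg (by omega)]
    have hy : IsPlan α (m + 1) n y := by
      refine ⟨fun i hi j hj => ?_, fun i hi => ?_, fun j hj => ?_⟩
      · simp only [hydef]
        split_ifs with h1 h2 h3
        · exact (hα.weight_pos _ _).le
        · exact le_rfl
        · exact mul_nonneg hc0 (hz.nonneg i h3 j (by simp; omega))
        · exact mul_nonneg hc1' (hα.weight_pos _ _).le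
      · rw [sum_range_eq_range_add_Ioc _ (show m ≤ n by omega),
          sum_congr rfl fun j hj => hylow i j (hmem hj), sum_ite_eq]
        rcases Nat.le_or_eq_of_le_succ hi with hi | rfl
        · rw [if_pos (by simp; omega), sum_congr rfl fun j hj => hyup i hi j hj, ← mul_sum,
            hz.row i hi, weight_succ hi, ← weight_mul_tailProd hi (show m ≤ n by omega), hQ]
          linear_combination weight α m i * hcQ
        · rw [if_neg (by simp), sum_congr rfl fun j hj => hylast j hj, ← mul_sum,
            sum_weight_Ioc (by omega), hQ, hc1, weight_self, zero_add, div_mul_cancel₀ _ hden.ne']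
      · rw [sum_range_succ]
        by_cases hjm : j ≤ m
        · simp_rw [hylow _ j hjm, sum_ite_eq']
          rw [if_pos (by simp; omega), if_neg (by omega), add_zero]
        · have hj' : j ∈ Ioc m n := by simp; omega
          rw [hylast j hj', sum_congr rfl fun i hi => hyup i (hmem hi) j hj', ← mul_sum,
            hz.col j hj']
          ring
    refine (hy.shifted_le hα).trans ?_
    have h1 : ∀ i ≤ m, ∑ j ∈ range (n + 1), y i j * shifted α i j =
        c * ∑ j ∈ Ioc m n, z i j * shifted α i j := fun i hi => by
      rw [sum_range_eq_range_add_Ioc _ (show m ≤ n by omega), sum_eq_zero, zero_add, mul_sum]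
      · exact sum_congr rfl fun j hj => by rw [hyup i hi j hj, mul_assoc]
      · intro j hj
        rw [hylow i j (hmem hj)]
        by_cases hij : i = j
        · rw [hij, hα.shifted_self, mul_zero]
        · rw [if_neg hij, zero_mul]
    have h2 : ∑ j ∈ range (n + 1), y (m + 1) j * shifted α (m + 1) j =
        (1 - c) * ∑ j ∈ Ioc m n, weight α n j * shifted α (m + 1) j := by
      rw [sum_range_eq_range_add_Ioc _ (show m ≤ n by omega), sum_eq_zero, zero_add, mul_sum]
      · exact sum_congr rfl fun j hj => by rw [hylast j hj, mul_assoc]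
      · intro j hj
        rw [hylow _ j (hmem hj), if_neg (by simp at hj; omega), zero_mul]
    have h3 : ∑ j ∈ Ioc m n, weight α n j * shifted α (m + 1) j ≤ residualCost α m n z := by
      rw [residualCost, sum_comm]
      refine sum_le_sum fun j hj => ?_
      rw [← hz.col j hj, sum_mul]
      exact sum_le_sum fun i hi =>
        mul_le_mul_of_nonneg_left (hmono i (hmem hi) j hj) (hz.nonneg i (hmem hi) j hj)
    rw [total, sum_range_succ, h2, sum_congr rfl fun i hi => h1 i (hmem hi), ← mul_sum, ← hc]
    have h4 := mul_le_mul_of_nonneg_left h3 hc1'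
    unfold residualCost at h4 ⊢
    linarith

theorem Admissible.shifted_mono_right (hα : Admissible α) {p q r : ℕ} (h : p ≤ q) (h' : q ≤ r) :
    shifted α p q ≤ shifted α p r := by
  induction r, h' using Nat.le_induction with
  | base => exact le_rfl
  | succ r hr ih => exact ih.trans (hα.shifted_succ_right_le (h.trans hr))

theorem Admissible.shifted_anti_left (hα : Admissible α) {p q r : ℕ} (h : p ≤ q) (h' : q ≤ r) :
    shifted α q r ≤ shifted α p r := by
  induction q, h using Nat.le_induction with
  | base => exact le_rfl
  | succ q hq ih => exact (hα.shifted_succ_left_le h').trans (ih (by omega))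

end Monotone

end KMBound

namespace KMBound

open Finset

/-! ### Inverse Monge costs and the northwest corner rule -/

theorem sum_range_mul_of_sum_eq_zero {N : ℕ} (c u : ℕ → ℝ) (h : ∑ q ∈ range N, u q = 0) :
    ∑ q ∈ range N, c q * u q =
      -∑ q ∈ range (N - 1), (c (q + 1) - c q) * ∑ q' ∈ range (q + 1), u q' := by
  have := sum_range_by_parts c u N
  simp only [smul_eq_mul] at this
  rw [this, h]; ring

/-- A perturbation with vanishing marginals and nonnegative corner sums does not increase a cost
satisfying the Monge condition. -/
theorem sum_sum_mul_nonpos_of_monge {M N : ℕ} (c u : ℕ → ℕ → ℝ)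
    (hrow : ∀ p < M, ∑ q ∈ range N, u p q = 0) (hcol : ∀ q < N, ∑ p ∈ range M, u p q = 0)
    (hU : ∀ p ≤ M, ∀ q ≤ N, 0 ≤ ∑ p' ∈ range p, ∑ q' ∈ range q, u p' q')
    (hc : ∀ p q, p + 1 < M → q + 1 < N → c p q + c (p + 1) (q + 1) ≤ c (p + 1) q + c p (q + 1)) :
    ∑ p ∈ range M, ∑ q ∈ range N, c p q * u p q ≤ 0 := by
  -- Summation by parts in q here and in p below leaves mixed second differences of c (nonpositive
  -- by Monge) times corner sums of u (nonnegative).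
  rw [sum_congr rfl fun p hp => sum_range_mul_of_sum_eq_zero (c p) (u p) (hrow p (by simpa using hp)),
    sum_neg_distrib, sum_comm, neg_nonpos]
  refine sum_nonneg fun q hq => ?_
  have hq : q + 1 < N := by simp at hq; omega
  have h0 : ∑ p ∈ range M, ∑ q' ∈ range (q + 1), u p q' = 0 := by
    rw [sum_comm]
    exact sum_eq_zero fun q' hq' => hcol q' (by simp at hq'; omega)
  rw [sum_range_mul_of_sum_eq_zero (fun p => c p (q + 1) - c p q)
    (fun p => ∑ q' ∈ range (q + 1), u p q') h0, neg_nonneg]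
  refine sum_nonpos fun p hp => mul_nonpos_of_nonpos_of_nonneg ?_ ?_
  · have := hc p q (by simp at hp; omega) hq
    linarith
  · exact hU _ (by simp at hp; omega) _ hq.le

/-- The corner sums of the northwest corner solution. -/
noncomputable def corner (a b : ℕ → ℝ) (p q : ℕ) : ℝ :=
  min (∑ p' ∈ range p, a p') (∑ q' ∈ range q, b q')

/-- The northwest corner solution of the transport problem with supplies `a` and demands `b`. -/
noncomputable def northwest (a b : ℕ → ℝ) (p q : ℕ) : ℝ :=
  corner a b (p + 1) (q + 1) - corner a b (p + 1) q - (corner a b p (q + 1) - corner a b p q)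

section Northwest

variable {a b : ℕ → ℝ}

theorem corner_zero_left (hb : ∀ q, 0 ≤ b q) (q : ℕ) : corner a b 0 q = 0 := by
  simpa [corner] using sum_nonneg fun q _ => hb q

theorem corner_zero_right (ha : ∀ p, 0 ≤ a p) (p : ℕ) : corner a b p 0 = 0 := by
  simpa [corner] using sum_nonneg fun p _ => ha p

theorem sum_northwest_row (ha : ∀ p, 0 ≤ a p) (p q : ℕ) :
    ∑ q' ∈ range q, northwest a b p q' = corner a b (p + 1) q - corner a b p q := by
  simp only [northwest]
  rw [sum_sub_distrib, sum_range_sub (corner a b (p + 1)), sum_range_sub (corner a b p),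
    corner_zero_right ha, corner_zero_right ha]
  ring

theorem sum_northwest_col (hb : ∀ q, 0 ≤ b q) (p q : ℕ) :
    ∑ p' ∈ range p, northwest a b p' q = corner a b p (q + 1) - corner a b p q := by
  have : ∀ p', northwest a b p' q = (corner a b (p' + 1) (q + 1) - corner a b (p' + 1) q) -
    (corner a b p' (q + 1) - corner a b p' q) := fun _ => rfl
  simp_rw [this]
  rw [sum_range_sub (fun p' => corner a b p' (q + 1) - corner a b p' q),
    corner_zero_left hb, corner_zero_left hb]
  ring

theorem sum_sum_northwest (ha : ∀ p, 0 ≤ a p) (hb : ∀ q, 0 ≤ b q) (p q : ℕ) :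
    ∑ p' ∈ range p, ∑ q' ∈ range q, northwest a b p' q' = corner a b p q := by
  rw [sum_congr rfl fun p' _ => sum_northwest_row ha p' q,
    sum_range_sub (fun p' => corner a b p' q), corner_zero_left hb, sub_zero]

/-- The minimum of a function of p and a function of q, both nondecreasing, has nonnegative mixed
differences. -/
theorem northwest_nonneg (ha : ∀ p, 0 ≤ a p) (hb : ∀ q, 0 ≤ b q) (p q : ℕ) :
    0 ≤ northwest a b p q := by
  simp only [northwest, corner, sum_range_succ]
  have := ha p
  have := hb q
  grind

/-- The northwest corner solution is the greedy one. -/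
theorem northwest_eq_min (ha : ∀ p, 0 ≤ a p) (hb : ∀ q, 0 ≤ b q) (p q : ℕ) :
    northwest a b p q = min (a p - ∑ q' ∈ range q, northwest a b p q')
      (b q - ∑ p' ∈ range p, northwest a b p' q) := by
  rw [sum_northwest_row ha, sum_northwest_col hb]
  simp only [northwest, corner, sum_range_succ]
  have := ha p
  have := hb q
  grind

end Northwest

/-! ### The inside-out transport -/

section InsideOut

variable {α : ℕ → ℝ} {m n : ℕ}

theorem sum_Ioc_eq_sum_range (f : ℕ → ℝ) (m n : ℕ) :
    ∑ j ∈ Ioc m n, f j = ∑ q ∈ range (n - m), f (m + 1 + q) := by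
  rw [← Nat.add_sub_add_right n 1 m, ← sum_Ico_eq_sum_range]
  exact sum_congr (by ext; simp) fun _ _ => rfl

theorem sum_range_reverse (f : ℕ → ℝ) (m : ℕ) :
    ∑ p ∈ range (m + 1), f (m - p) = ∑ i ∈ range (m + 1), f i := by
  simpa using sum_range_reflect f (m + 1)

/-- The residual supply of the source `m - p`. -/
noncomputable def residualSupply (α : ℕ → ℝ) (m n p : ℕ) : ℝ :=
  weight α m (m - p) - weight α n (m - p)

/-- The residual demand of the destination `m + 1 + q`. -/
noncomputable def residualDemand (α : ℕ → ℝ) (m n q : ℕ) : ℝ :=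
  weight α n (m + 1 + q)

theorem residualSupply_nonneg (hα : Admissible α) (h : m ≤ n) (p : ℕ) :
    0 ≤ residualSupply α m n p :=
  sub_nonneg.2 (hα.weight_anti (Nat.sub_le _ _) h)

theorem residualDemand_nonneg (hα : Admissible α) (q : ℕ) : 0 ≤ residualDemand α m n q :=
  (hα.weight_pos _ _).le

theorem insideOutFlow_of_le {i j : ℕ} (h : j ≤ m) :
    insideOutFlow α m n i j = if i = j then weight α n j else 0 := by
  rw [insideOutFlow, if_pos h]

/-- Both sides satisfy the same greedy recursion in the coordinates i = m - p, j = m + 1 + q; the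
nested inductions follow its order of service. -/
theorem insideOutFlow_eq_northwest (hα : Admissible α) (h : m ≤ n) {p : ℕ} (hp : p ≤ m) (q : ℕ) :
    insideOutFlow α m n (m - p) (m + 1 + q) =
      northwest (residualSupply α m n) (residualDemand α m n) p q := by
  induction q using Nat.strong_induction_on generalizing p with
  | _ q ihq =>
  induction p using Nat.strong_induction_on with
  | _ p ihp =>
  rw [insideOutFlow, if_neg (by omega), northwest_eq_min (residualSupply_nonneg hα h)
    (residualDemand_nonneg hα), Fin.sum_univ_eq_sum_range
    (fun j => insideOutFlow α m n (m - p) j) (m + 1 + q),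
    Fin.sum_univ_eq_sum_range (fun i => insideOutFlow α m n (m - i) (m + 1 + q)) (m - (m - p)),
    sum_range_add, Nat.sub_sub_self hp]
  congr 1
  -- Among the destinations j ≤ m only the twin receives anything, so subtracting these flows turns
  -- the supply into `residualSupply`.
  · rw [sum_congr rfl fun j hj => insideOutFlow_of_le (show j ≤ m by simp at hj; omega),
      sum_ite_eq, if_pos (by simp),
      sum_congr rfl fun q' hq' => ihq q' (by simpa using hq') hp, residualSupply]
    ring
  · rw [sum_congr rfl fun p' hp' => ihp p' (by simpa using hp') (by simp at hp'; omega)]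
    rfl

theorem ofResidual_insideOutFlow :
    ofResidual α m n (insideOutFlow α m n) = insideOutFlow α m n := by
  ext i j
  rw [ofResidual]
  split_ifs with h1 h2
  · rw [insideOutFlow_of_le h1, if_pos h2]
  · rw [insideOutFlow_of_le h1, if_neg h2]
  · rfl

theorem sum_residualSupply (hα : Admissible α) (h : m ≤ n) :
    ∑ p ∈ range (m + 1), residualSupply α m n p = 1 - tailProd α m n := by
  simp only [residualSupply]
  rw [sum_range_reverse (fun i => weight α m i - weight α n i), sum_sub_distrib, hα.sum_weight,
    ← sum_weight_Ioc h]
  have := hα.sum_weight n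
  rw [sum_range_eq_range_add_Ioc _ h] at this
  linarith

theorem sum_residualDemand (h : m ≤ n) :
    ∑ q ∈ range (n - m), residualDemand α m n q = 1 - tailProd α m n := by
  rw [← sum_weight_Ioc h, sum_Ioc_eq_sum_range]
  rfl

theorem isResidual_insideOutFlow (hα : Admissible α) (h : m ≤ n) :
    IsResidual α m n (insideOutFlow α m n) := by
  have hS := residualSupply_nonneg hα h
  have hD := residualDemand_nonneg (m := m) (n := n) hα
  have hA : ∀ p ≤ m + 1, corner (residualSupply α m n) (residualDemand α m n) p (n - m) =
      ∑ p' ∈ range p, residualSupply α m n p' := fun p hp => by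
    rw [corner, sum_residualDemand h, ← sum_residualSupply hα h]
    exact min_eq_left (sum_le_sum_of_subset_of_nonneg (range_subset_range.2 hp) fun i _ _ => hS i)
  have hB : ∀ q ≤ n - m, corner (residualSupply α m n) (residualDemand α m n) (m + 1) q =
      ∑ q' ∈ range q, residualDemand α m n q' := fun q hq => by
    rw [corner, sum_residualSupply hα h, ← sum_residualDemand h]
    exact min_eq_right (sum_le_sum_of_subset_of_nonneg (range_subset_range.2 hq) fun i _ _ => hD i)
  refine ⟨fun i hi j hj => ?_, fun i hi => ?_, fun j hj => ?_⟩
  · obtain ⟨q, rfl⟩ : ∃ q, j = m + 1 + q := ⟨j - (m + 1), by simp at hj; omega⟩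
    rw [← Nat.sub_sub_self hi, insideOutFlow_eq_northwest hα h (Nat.sub_le _ _)]
    exact northwest_nonneg hS hD _ _
  · obtain ⟨p, hp, rfl⟩ : ∃ p ≤ m, i = m - p := ⟨m - i, by omega, by omega⟩
    rw [sum_Ioc_eq_sum_range, sum_congr rfl fun q _ => insideOutFlow_eq_northwest hα h hp q,
      sum_northwest_row hS, hA _ (by omega), hA _ (by omega), sum_range_succ, residualSupply,
      ← weight_mul_tailProd (Nat.sub_le m p) h]
    ring
  · obtain ⟨q, rfl⟩ : ∃ q, j = m + 1 + q := ⟨j - (m + 1), by simp at hj; omega⟩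
    simp only [mem_Ioc] at hj
    rw [← sum_range_reverse, sum_congr rfl fun p hp =>
      insideOutFlow_eq_northwest hα h (show p ≤ m by simp at hp; omega) q,
      sum_northwest_col hD, hB _ (by omega), hB _ (by omega), sum_range_succ, residualDemand]
    ring

theorem residualCost_eq_sum_range (y : ℕ → ℕ → ℝ) :
    residualCost α m n y = ∑ p ∈ range (m + 1), ∑ q ∈ range (n - m),
      shifted α (m - p) (m + 1 + q) * y (m - p) (m + 1 + q) := by
  rw [residualCost, ← sum_range_reverse]
  refine sum_congr rfl fun p _ => ?_
  rw [sum_Ioc_eq_sum_range]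
  exact sum_congr rfl fun q _ => mul_comm _ _

theorem residualCost_insideOutFlow_le (hα : Admissible α) (h : m ≤ n)
    (h4 : ∀ i k j l, i ≤ k → k ≤ j → j ≤ l →
      shifted α i l + shifted α k j ≤ shifted α i j + shifted α k l)
    {y : ℕ → ℕ → ℝ} (hy : IsResidual α m n y) :
    residualCost α m n (insideOutFlow α m n) ≤ residualCost α m n y := by
  have hw := isResidual_insideOutFlow hα h
  have hmem : ∀ {q}, q < n - m → m + 1 + q ∈ Ioc m n := fun hq => by simp; omega
  have key := sum_sum_mul_nonpos_of_monge (M := m + 1) (N := n - m)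
    (fun p q => shifted α (m - p) (m + 1 + q))
    (fun p q => insideOutFlow α m n (m - p) (m + 1 + q) - y (m - p) (m + 1 + q))
    (fun p hp => ?_) (fun q hq => ?_) (fun p hp q hq => ?_) (fun p q hp hq => ?_)
  · rw [residualCost_eq_sum_range, residualCost_eq_sum_range, ← sub_nonpos, ← sum_sub_distrib]
    simpa only [mul_sub, sum_sub_distrib] using key
  · rw [sum_sub_distrib, ← sum_Ioc_eq_sum_range, ← sum_Ioc_eq_sum_range,
      hw.row _ (Nat.sub_le _ _), hy.row _ (Nat.sub_le _ _), sub_self]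
  · rw [sum_sub_distrib, sum_range_reverse (fun i => insideOutFlow α m n i (m + 1 + q)),
      sum_range_reverse (fun i => y i (m + 1 + q)), hw.col _ (hmem hq), hy.col _ (hmem hq), sub_self]
  · simp only [sum_sub_distrib]
    have hle : ∀ {p'}, p' ∈ range p → p' ≤ m := fun h => by simp at h; omega
    rw [sum_congr rfl fun p' hp' => sum_congr rfl fun q' _ =>
      insideOutFlow_eq_northwest hα h (hle hp') q',
      sum_sum_northwest (residualSupply_nonneg hα h) (residualDemand_nonneg hα), sub_nonneg]
    have hnn : ∀ p', ∀ q' ∈ range (n - m), 0 ≤ y (m - p') (m + 1 + q') := fun p' q' hq' =>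
      hy.nonneg _ (Nat.sub_le _ _) _ (hmem (by simpa using hq'))
    have hsub : range q ⊆ range (n - m) := range_subset_range.2 hq
    -- A corner sum of any plan is at most the supplies of its rows and at most the demands of its
    -- columns; the northwest rule attains the smaller bound.
    refine le_min (sum_le_sum fun p' hp' => ?_) ?_
    · have hrow := hy.row (m - p') (Nat.sub_le _ _)
      rw [sum_Ioc_eq_sum_range] at hrow
      rw [residualSupply, ← weight_mul_tailProd (Nat.sub_le _ _) h]
      refine (sum_le_sum_of_subset_of_nonneg hsub fun q' hq' _ => hnn p' q' hq').trans ?_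
      rw [hrow]
      exact le_of_eq (by ring)
    · rw [sum_comm]
      refine sum_le_sum fun q' hq' => ?_
      rw [residualDemand, ← hy.col _ (hmem (by simpa using hsub hq')), ← sum_range_reverse]
      exact sum_le_sum_of_subset_of_nonneg (range_subset_range.2 hp)
        fun p' _ _ => hnn p' q' (hsub hq')
  -- Reversing the sources exchanges the roles of i and k, which turns the 4-point inequality into
  -- the Monge condition.
  · have := h4 (m - (p + 1)) (m - p) (m + 1 + q) (m + 1 + (q + 1)) (by omega) (by omega) (by omega)
    linarith

/-- `FourPoint` does not cover the index -1, which occurs among the costs. There two of the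
distances equal 1, and the inequality reduces to monotonicity. -/
theorem fourPoint_shifted (hα : Admissible α) (h : FourPoint α) (i k j l : ℕ) (hik : i ≤ k)
    (hkj : k ≤ j) (hjl : j ≤ l) :
    shifted α i l + shifted α k j ≤ shifted α i j + shifted α k l := by
  rcases Nat.eq_zero_or_pos k with rfl | hk
  · obtain rfl : i = 0 := by omega
    linarith
  obtain ⟨k, rfl⟩ : ∃ k', k = k' + 1 := ⟨k - 1, by omega⟩
  obtain ⟨j, rfl⟩ : ∃ j', j = j' + 1 := ⟨j - 1, by omega⟩
  obtain ⟨l, rfl⟩ : ∃ l', l = l' + 1 := ⟨l - 1, by omega⟩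
  cases i with
  | zero => simpa using hα.shifted_mono_right hkj hjl
  | succ i =>
    simpa only [d_natCast] using h i k j l (by omega) (by omega) (by omega)

theorem isOptimal_insideOut (hα : Admissible α) (h4 : FourPoint α) (h : m ≤ n) :
    IsOptimal α m n (insideOut α m n) := by
  have hw := isResidual_insideOutFlow hα h
  have := (isOptimal_restrict_iff (m := m) (n := n) (z := insideOutFlow α m n) hα).2 ⟨?_, ?_⟩
  · exact this
  · rw [← ofResidual_insideOutFlow]
    exact hw.isPlan hα h
  · rw [← ofResidual_insideOutFlow, total_ofResidual hα h]
    obtain ⟨y, hy, hc⟩ := exists_isResidual_eq hα h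
    refine le_antisymm ?_ (hw.shifted_le hα h)
    rw [← hc]
    exact residualCost_insideOutFlow_le hα h (fourPoint_shifted hα h4) hy

end InsideOut

end KMBound

namespace KMBound

open Finset

/-! ### The 4-point inequality for steps at least one half -/

section Half

variable {α : ℕ → ℝ}

/-- The 4-point inequality for indices up to `N`. -/
def FourPointUpTo (α : ℕ → ℝ) (N : ℕ) : Prop :=
  ∀ i k j l, i ≤ k → k ≤ j → j ≤ l → l ≤ N →
    shifted α i l + shifted α k j ≤ shifted α i j + shifted α k l

/-- Mixed differences over a rectangle are sums of those over unit cells. -/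
theorem fourPointUpTo_of_succ {N : ℕ} (h : ∀ p q, p + 1 ≤ q → q + 1 ≤ N →
    shifted α p (q + 1) + shifted α (p + 1) q ≤ shifted α p q + shifted α (p + 1) (q + 1)) :
    FourPointUpTo α N := by
  have h1 : ∀ p j l, p + 1 ≤ j → j ≤ l → l ≤ N →
      shifted α p l + shifted α (p + 1) j ≤ shifted α p j + shifted α (p + 1) l := by
    intro p j l hpj hjl
    induction l, hjl using Nat.le_induction with
    | base => exact fun _ => le_rfl
    | succ l hl ih =>
      intro hN
      have := ih (by omega)
      have := h p l (by omega) hN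
      linarith
  intro i k j l hik
  induction k, hik using Nat.le_induction with
  | base => intros; linarith
  | succ k hk ih =>
    intro hkj hjl hN
    have := ih (by omega) hjl hN
    have := h1 k j l hkj hjl hN
    linarith

/-- The average of `D(i, x)` over `i` distributed according to `π^m`. -/
noncomputable def sourceMean (α : ℕ → ℝ) (m x : ℕ) : ℝ :=
  ∑ i ∈ range (m + 1), weight α m i * shifted α i x

/-- The cost of serving all the demands `j ∈ (m, n]` from `x`. -/
noncomputable def demandCost (α : ℕ → ℝ) (m n x : ℕ) : ℝ :=
  ∑ j ∈ Ioc m n, weight α n j * shifted α x j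

/-- For m < n the optimal residual plan is explicit: sources i < m send everything to n, while m
serves all of (m, n) and sends its remainder to n. Optimality is a duality argument with the
potentials D(i, n) and D(m, j) - D(m, n). -/
theorem shifted_eq_of_half_le (hα : Admissible α) (hhalf : ∀ k, 1 / 2 ≤ α k) {m n : ℕ}
    (h : m ≤ n) (h4 : FourPointUpTo α n) :
    shifted α (m + 1) (n + 1) = (1 - tailProd α m n) * sourceMean α m n + demandCost α m n m -
      (1 - tailProd α m n) * shifted α m n := by
  rcases h.eq_or_lt with rfl | hmn
  · simp [tailProd_self, demandCost, hα.shifted_self]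
  set Q := tailProd α m n with hQ
  have hQ1 : Q ≤ 1 := hα.tailProd_le_one m n
  have hQ0 : 0 < Q := hα.tailProd_pos m n
  have hmem : ∀ {i l : ℕ}, i ∈ range (l + 1) → i ≤ l := fun h => by simp at h; omega
  have hnI : n ∈ Ioc m n := by simp; omega
  have hmI : m ∈ range (m + 1) := by simp
  apply le_antisymm
  · have hy : IsResidual α m n fun i j => (if j = n then weight α m i * (1 - Q) else 0) +
        (if i = m then weight α n j else 0) -
        if i = m then if j = n then 1 - Q else 0 else 0 := by
      refine ⟨fun i _ j _ => ?_, fun i _ => ?_, fun j _ => ?_⟩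
      · have hw := hα.weight_pos m i
        have hw' := hα.weight_pos n j
        have h1 : 0 ≤ weight α m i * (1 - Q) := mul_nonneg hw.le (by linarith)
        by_cases hj : j = n
        · by_cases hi : i = m
          · subst hi hj
            simp only [if_true, weight_self]
            -- The entry at (m, n) is α_n - (1 - α_m)(1 - Q), nonnegative because α_n ≥ 1/2 ≥ 1 -
            -- α_m.
            nlinarith [hhalf i, hhalf j]
          · simpa [hi, hj] using h1
        · by_cases hi : i = m
          · simpa [hi, hj] using hw'.le
          · simp [hi, hj]
      · rw [sum_sub_distrib, sum_add_distrib, sum_ite_eq', if_pos hnI]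
        by_cases hi : i = m
        · simp only [hi, if_true]
          rw [sum_ite_eq', if_pos hnI, sum_weight_Ioc h]
          ring
        · simp [hi, hQ]
      · rw [sum_sub_distrib, sum_add_distrib, sum_ite_eq', sum_ite_eq', if_pos hmI, if_pos hmI]
        by_cases hj : j = n
        · simp only [hj, if_true]
          rw [← sum_mul, hα.sum_weight]
          ring
        · simp [hj]
    refine (hy.shifted_le hα h).trans_eq ?_
    simp only [residualCost, sub_mul, add_mul, ite_mul, zero_mul, sum_sub_distrib, sum_add_distrib,
      sum_ite_eq', if_pos hnI]
    rw [sum_comm (t := Ioc m n), sum_comm (t := Ioc m n)]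
    simp only [sum_ite_eq', if_pos hmI, if_pos hnI, sourceMean, demandCost, one_mul,
      mul_sum]
    congr 2
    simp only [← sum_sub_distrib]
    exact sum_congr rfl fun i _ => by ring
  · obtain ⟨y, hy, hc⟩ := exists_isResidual_eq hα h
    rw [← hc]
    have h1 : (1 - Q) * sourceMean α m n = ∑ i ∈ range (m + 1), ∑ j ∈ Ioc m n,
        y i j * shifted α i n := by
      rw [sourceMean, mul_sum]
      refine sum_congr rfl fun i hi => ?_
      rw [← sum_mul, hy.row i (hmem hi)]
      ring
    have h2 : demandCost α m n m = ∑ i ∈ range (m + 1), ∑ j ∈ Ioc m n,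
        y i j * shifted α m j := by
      rw [demandCost, sum_comm]
      refine sum_congr rfl fun j hj => ?_
      rw [← sum_mul, hy.col j hj]
    have h3 : (1 - Q) * shifted α m n = ∑ i ∈ range (m + 1), ∑ j ∈ Ioc m n,
        y i j * shifted α m n := by
      rw [← sum_weight_Ioc h, sum_mul, sum_comm]
      refine sum_congr rfl fun j hj => ?_
      rw [← sum_mul, hy.col j hj]
    rw [h1, h2, h3, ← sum_add_distrib, ← sum_sub_distrib]
    refine sum_le_sum fun i hi => ?_
    rw [← sum_add_distrib, ← sum_sub_distrib]
    refine sum_le_sum fun j hj => ?_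
    rw [← mul_add, ← mul_sub]
    have hj' := mem_Ioc.1 hj
    -- This gives D(i, j) ≥ D(i, n) + D(m, j) - D(m, n), a separable lower bound whose total depends
    -- only on the marginals.
    have := h4 i m j n (hmem hi) hj'.1.le hj'.2 le_rfl
    exact mul_le_mul_of_nonneg_left (by linarith) (hy.nonneg i (hmem hi) j hj)

/-- With δ the slack of the inequality `hδ` on the preceding cell, the new slack equals
a·slack(`hK`) + β·slack(`hH`) + (β(1 - (1 - a)Q) - (1 - Q)(1 - a))·δ. Here `hK` and `hH` are
averages of earlier 4-point inequalities. -/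
theorem fourPoint_step (hα : Admissible α) (hhalf : ∀ k, 1 / 2 ≤ α k) {m n : ℕ}
    (h : m + 1 ≤ n) (h4 : FourPointUpTo α (n + 1)) :
    shifted α (m + 1) (n + 2) + shifted α (m + 2) (n + 1) ≤
      shifted α (m + 1) (n + 1) + shifted α (m + 2) (n + 2) := by
  have h4' : FourPointUpTo α n := fun i k j l h1 h2 h3 h4 => by apply_assumption <;> omega
  rw [shifted_eq_of_half_le hα hhalf (show m ≤ n by omega) h4',
    shifted_eq_of_half_le hα hhalf (show m ≤ n + 1 by omega) h4,
    shifted_eq_of_half_le hα hhalf h h4',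
    shifted_eq_of_half_le hα hhalf (show m + 1 ≤ n + 1 by omega) h4]
  set a := α (m + 1)
  set β := α (n + 1)
  set Q := tailProd α (m + 1) n with hQ
  have hmem : ∀ {i l : ℕ}, i ∈ range (l + 1) → i ≤ l := fun h => by simp at h; omega
  have hQ1 : Q ≤ 1 := hα.tailProd_le_one _ _
  have hQ0 : 0 < Q := hα.tailProd_pos _ _
  have e1 : tailProd α m n = (1 - a) * Q := tailProd_succ_left h
  have e2 : tailProd α (m + 1) (n + 1) = Q * (1 - β) := tailProd_succ_right h
  have e3 : tailProd α m (n + 1) = (1 - a) * Q * (1 - β) := by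
    rw [tailProd_succ_right (by omega), e1]
  have e4 : ∀ x, sourceMean α (m + 1) x = (1 - a) * sourceMean α m x + a * shifted α (m + 1) x :=
    fun x => sum_weight_range_mul (fun i => shifted α i x) m
  have e5 : demandCost α m (n + 1) m = (1 - β) * demandCost α m n m + β * shifted α m (n + 1) :=
    sum_weight_Ioc_mul (shifted α m) (by omega)
  have e6 : demandCost α (m + 1) (n + 1) (m + 1) =
      (1 - β) * demandCost α (m + 1) n (m + 1) + β * shifted α (m + 1) (n + 1) :=
    sum_weight_Ioc_mul (shifted α (m + 1)) h
  -- Adding j = m+1 to the range is free, because D(m+1, m+1) = 0.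
  have e7 : demandCost α (m + 1) n (m + 1) = demandCost α m n (m + 1) := by
    refine sum_subset (Ioc_subset_Ioc_left (by omega)) fun j hj hj' => ?_
    obtain rfl : j = m + 1 := by simp at hj hj'; omega
    rw [hα.shifted_self, mul_zero]
  have hH : (1 - (1 - a) * Q) * (shifted α m n - shifted α (m + 1) n) ≤
      demandCost α m n m - demandCost α m n (m + 1) := by
    rw [← e1, ← sum_weight_Ioc (show m ≤ n by omega), demandCost, demandCost, ← sum_sub_distrib,
      sum_mul]
    refine sum_le_sum fun j hj => ?_
    rw [← mul_sub]
    have hj' := mem_Ioc.1 hj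
    have := h4' m (m + 1) j n (by omega) hj'.1 hj'.2 le_rfl
    exact mul_le_mul_of_nonneg_left (by linarith) (hα.weight_pos _ _).le
  have hK : shifted α m n - shifted α m (n + 1) ≤ sourceMean α m n - sourceMean α m (n + 1) := by
    rw [sourceMean, sourceMean, ← sum_sub_distrib, ← one_mul (_ - _), ← hα.sum_weight m, sum_mul]
    refine sum_le_sum fun i hi => ?_
    rw [← mul_sub]
    have := h4 i m n (n + 1) (hmem hi) (by omega) (by omega) le_rfl
    exact mul_le_mul_of_nonneg_left (by linarith) (hα.weight_pos _ _).le
  have hδ := h4 m (m + 1) n (n + 1) (by omega) h (by omega) le_rfl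
  have hβ : 1 / 2 ≤ β := hhalf _
  have ha : 1 / 2 ≤ a := hhalf _
  -- The bracket equals (β + a - 1)(1 - Q) + βaQ.
  have hbr : 0 ≤ β * (1 - (1 - a) * Q) - (1 - Q) * (1 - a) := by
    have hz : 0 ≤ a * Q := by positivity
    nlinarith [mul_nonneg (show (0 : ℝ) ≤ β + a - 1 by linarith) (show (0 : ℝ) ≤ 1 - Q by linarith),
      mul_nonneg (show (0 : ℝ) ≤ β by linarith) hz]
  have hp1 := mul_nonneg hbr (sub_nonneg.2 hδ)
  have hp2 := mul_le_mul_of_nonneg_left hK (show (0 : ℝ) ≤ a by linarith)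
  have hp3 := mul_le_mul_of_nonneg_left hH (show (0 : ℝ) ≤ β by linarith)
  rw [e1, e2, e3, e4, e4, e5, e6, e7]
  linarith

/-- Only the unit cells in the last column are new. The one with p = 0 is monotonicity, the others
are `fourPoint_step`. -/
theorem fourPointUpTo_of_half_le (hα : Admissible α) (hhalf : ∀ k, 1 / 2 ≤ α k) (N : ℕ) :
    FourPointUpTo α N := by
  induction N with
  | zero => exact fourPointUpTo_of_succ fun p q _ hq => by omega
  | succ N ih =>
    refine fourPointUpTo_of_succ fun p q hpq hq => ?_
    rcases (show q ≤ N by omega).eq_or_lt with rfl | hlt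
    · cases p with
      | zero =>
        have := hα.shifted_mono_right hpq (Nat.le_succ q)
        obtain ⟨q, rfl⟩ : ∃ q', q = q' + 1 := ⟨q - 1, by omega⟩
        simpa using this
      | succ m =>
        obtain ⟨n, rfl⟩ : ∃ n, q = n + 1 := ⟨q - 1, by omega⟩
        exact fourPoint_step hα hhalf (by omega) ih
    · exact ih p (p + 1) q (q + 1) (by omega) hpq (by omega) (by omega)

theorem fourPoint_of_half_le (hα : Admissible α) (hhalf : ∀ k, 1 / 2 ≤ α k) : FourPoint α := by
  intro i k j l hik hkj hjl
  simp only [d_natCast]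
  exact fourPointUpTo_of_half_le hα hhalf (l + 1) _ _ _ _ (by omega) (by omega) (by omega) le_rfl

end Half

end KMBound

theorem theorem4 (α : ℕ → ℝ) (hα0 : α 0 = 1) (hα : ∀ k : ℕ, 1 ≤ k → 0 < α k ∧ α k < 1) :
    -- the minimum defining `d_{mn}` is attained
    (∀ m n : ℕ, IsLeast (KMBound.cost α m n '' KMBound.plans α m n) (KMBound.d α m n)) ∧
    -- (a) `d` is a metric on `{-1, 0, 1, …}` with values in `[0, 1]`
    ((∀ m n : ℤ, -1 ≤ m → -1 ≤ n → KMBound.d α m n ∈ Set.Icc (0 : ℝ) 1) ∧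
      (∀ m n : ℤ, -1 ≤ m → -1 ≤ n → (KMBound.d α m n = 0 ↔ m = n)) ∧
      (∀ m n : ℤ, -1 ≤ m → -1 ≤ n → KMBound.d α m n = KMBound.d α n m) ∧
      (∀ m n p : ℤ, -1 ≤ m → -1 ≤ n → -1 ≤ p →
        KMBound.d α m n ≤ KMBound.d α m p + KMBound.d α p n)) ∧
    -- (b) existence of simple optimal plans, and monotonicity
    (∀ m n : ℕ, m ≤ n → ∃ z : Fin (m + 1) → Fin (n + 1) → ℝ, KMBound.IsOptimal α m n z ∧
      (∀ (i : Fin (m + 1)) (j : Fin (n + 1)), (j : ℕ) = i → z i j = KMBound.weight α n i) ∧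
      (∀ (i : Fin (m + 1)) (j : Fin (n + 1)), (j : ℕ) ≤ m → (j : ℕ) ≠ i → z i j = 0)) ∧
    (∀ m : ℤ, -1 ≤ m →
      AntitoneOn (fun n : ℤ => KMBound.d α m n) (Set.Icc (-1) m) ∧
      MonotoneOn (fun n : ℤ => KMBound.d α m n) (Set.Ici m)) ∧
    -- (c) the 4-point inequality when all `α_k ≥ 1/2`, and what it implies
    ((∀ k : ℕ, 1 / 2 ≤ α k) →
      KMBound.FourPoint α ∧
      ∀ m n : ℕ, m ≤ n → KMBound.IsOptimal α m n (KMBound.insideOut α m n)) ∧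
    (KMBound.FourPoint α →
      ∀ m n : ℕ, m ≤ n → KMBound.IsOptimal α m n (KMBound.insideOut α m n)) := by
  have h : KMBound.Admissible α := by
    refine ⟨hα0, fun k => ?_, fun k hk => (hα k hk).2⟩
    rcases Nat.eq_zero_or_pos k with rfl | hk
    · rw [hα0]; exact one_pos
    · exact (hα k hk).1
  refine ⟨KMBound.isLeast_cost h, ⟨fun m n _ _ => h.shifted_mem_Icc _ _, fun m n hm hn => ?_,
    fun m n _ _ => h.shifted_comm _ _, fun m n p _ _ _ => h.shifted_triangle _ _ _⟩,
    fun m n hmn => ?_, fun m hm => ⟨?_, ?_⟩, fun hhalf => ?_,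
    fun h4 m n hmn => KMBound.isOptimal_insideOut h h4 hmn⟩
  · rw [KMBound.d, h.shifted_eq_zero_iff]
    omega
  · obtain ⟨z, hz, hc, hs⟩ := KMBound.exists_simple_isPlan_eq h hmn
    refine ⟨KMBound.restrict m n z, (KMBound.isOptimal_restrict_iff h).2 ⟨hz, hc⟩,
      fun i j hij => ?_, fun i j hj hij => ?_⟩
    · rw [KMBound.restrict, hij]
      exact hs i (by omega)
    · exact hz.eq_zero_of_simple hmn hs (by omega) hj hij.symm
  · rintro p hp q hq hpq
    simp only [Set.mem_Icc] at hp hq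
    simp only [KMBound.d]
    -- Below m the varying index is the smaller one, so symmetry moves it to the left argument.
    rw [h.shifted_comm _ (q + 1).toNat, h.shifted_comm _ (p + 1).toNat]
    exact h.shifted_anti_left (by omega) (by omega)
  · rintro p hp q hq hpq
    simp only [Set.mem_Ici] at hp hq
    exact h.shifted_mono_right (by omega) (by omega)
  · have h4 := KMBound.fourPoint_of_half_le h hhalf
    exact ⟨h4, fun m n hmn => KMBound.isOptimal_insideOut h h4 hmn⟩
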